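/- Let $\alpha>0$, let $\Omega\subset\mathbb{R}^2$ be a bounded domain (a non-empty, connected, open set) and let $\varphi:\partial\Omega\to\mathbb{R}$ be continuous. A \emph{solution} is a function $u\in C^2(\overline\Omega)$ (that is, $u$ is $C^2$ in $\Omega$, and $u$ and its first and second derivatives extend continuously to $\overline\Omega$; $Du$ on $\partial\Omega$ denotes this extension) with $$\operatorname{div}\left(\frac{Du}{\sqrt{1+|Du|^2}}\right)=\left(\frac{1}{\sqrt{1+|Du|^2}}\right)^{\alpha}\ \text{ in }\Omega,\qquad u=\varphi\ \text{ on }\partial\Omega .$$ An \emph{$\alpha$-bowl soliton} is a radially symmetric, strictly convex $C^2$ function $\mathbf b:\mathbb{R}^2\to\mathbb{R}$ that satisfies the same equation on all of $\mathbb{R}^2$ and has its global minimum at the origin. Then: 1. There is at most one solution $u$. 2. There is a constant $C$, depending only on $\alpha$, $\Omega$ and $\varphi$, such that every solution $u$ satisfies $$C\le u\le \max_{\partial\Omega}\varphi\quad\text{in }\Omega .$$ More precisely, whenever $\overline\Omega$ is contained in an open disc of radius $R$, there is an $\alpha$-bowl soliton $\mathbf b$ that vanishes on the circle $|x|=R$,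 and for every such $\mathbf b$ the lower bound holds with $C=\mathbf b(0)+\min_{\partial\Omega}\varphi$. 3. For every solution $u$, the maximum of $|Du|$ is attained on the boundary: $$\max_{\overline\Omega}|Du|=\max_{\partial\Omega}|Du| .$$ -/

import Mathlib

open Set Metric

noncomputable section

/-- The Euclidean plane. -/
abbrev Plane : Type := EuclideanSpace ℝ (Fin 2)

/-- The divergence `∂F₁/∂x₁ + ∂F₂/∂x₂` of a planar vector field. -/
def planeDiv (F : Plane → Plane) (x : Plane) : ℝ :=
  ∑ i : Fin 2, fderiv ℝ (fun y => F y i) x (EuclideanSpace.single i 1)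

/-- `u` satisfies the `α`-translating soliton equation
`div (Du / √(1 + |Du|²)) = (1 / √(1 + |Du|²)) ^ α` at the point `x`. -/
def SolitonEqAt (α : ℝ) (u : Plane → ℝ) (x : Plane) : Prop :=
  planeDiv (fun y => (1 / √(1 + ‖gradient u y‖ ^ 2)) • gradient u y) x
    = (1 / √(1 + ‖gradient u x‖ ^ 2)) ^ α

/-- `u ∈ C²(closure Ω)`, for an open set `Ω`: `u` is of class `C²` in `Ω`, it is continuous on the
closure, and its derivatives of first and second order extend continuously to the closure. -/
structure IsC2UpToBoundary (Ω : Set Plane) (u : Plane → ℝ) : Prop where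
  contDiffOn : ContDiffOn ℝ 2 u Ω
  continuousOn : ContinuousOn u (closure Ω)
  gradient_extends : ∃ G : Plane → Plane,
    ContinuousOn G (closure Ω) ∧ EqOn G (gradient u) Ω
  hessian_extends : ∃ H : Plane → (Plane →L[ℝ] Plane),
    ContinuousOn H (closure Ω) ∧ EqOn H (fderiv ℝ (gradient u)) Ω

/-- The gradient `Du` on the closure of `Ω`: at each point, the limit of the gradient from
inside `Ω`. -/
def closureGradient (Ω : Set Plane) (u : Plane → ℝ) : Plane → Plane :=
  extendFrom Ω (gradient u)

/-- `u ∈ C²(closure Ω)` solves the Dirichlet problem for the `α`-translating soliton equation in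
`Ω` with boundary values `φ`. -/
structure IsDirichletSolution (α : ℝ) (Ω : Set Plane) (φ u : Plane → ℝ) : Prop where
  regular : IsC2UpToBoundary Ω u
  equation : ∀ x ∈ Ω, SolitonEqAt α u x
  boundary : ∀ x ∈ frontier Ω, u x = φ x

/-- `b` is an `α`-bowl soliton with the `z`-axis as its axis: an entire, radially symmetric,
strictly convex solution of the equation, with its global minimum on the axis. -/
structure IsBowlSoliton (α : ℝ) (b : Plane → ℝ) : Prop where
  contDiff : ContDiff ℝ 2 b
  equation : ∀ x, SolitonEqAt α b x
  radial : ∀ x y, ‖x‖ = ‖y‖ → b x = b y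
  strictConvex : StrictConvexOn ℝ univ b
  minimum : ∀ x, b 0 ≤ b x

end

/-!
After multiplication by `(1 + |Du|²) ^ (3 / 2)` the equation reads
`D²u(e₁, e₁) + D²u(e₂, e₂) + D²u(p⊥, p⊥) = f(p)`, where `p = Du`, `p⊥` is `p` rotated by a right
angle and `f` is a `C¹` function. Since `u` itself does not occur, sub- and supersolutions satisfy a
comparison principle (`le_of_solitonOp_le`): at an interior maximum of `u - v + ε exp (l x₀)` the
gradients differ by a small multiple of the first basis vector, and for large `l` the second
derivatives contradict the Lipschitz bounds for the remaining terms. Only the second-derivative test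
along lines is needed.

Uniqueness, the upper bound (constants are supersolutions) and the lower bound (translates of bowl
solitons are solutions, nonpositive on their disc) are direct applications of comparison. For the
gradient bound (`IsDirichletSolution.norm_closureGradient_le`) the solution is compared with its own
small translates in the direction of the gradient at a point where the bound fails. This takes place
on a superlevel set of a directional derivative whose closure lies in `Ω`, so that neither
regularity of the boundary nor third derivatives of `u` enter.

The bowl soliton (`exists_isBowlSoliton`) has the form `b(x) = B(|x|²)`. Let `v` be its radial slope
at radius `r = √ρ` and put `κ(ρ) = v / (r √(1 + v²))`. The equation becomes
`2 (ρ κ)' = (1 - ρ κ²) ^ (α / 2)`: `κ(ρ)` is half the average over `[0, ρ]` of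
`(1 - η κ(η)²) ^ (α / 2)`. The right-hand side need not be Lipschitz near `ρ κ² = 1`, so it is
truncated by a barrier `δ(ρ)`; the truncated equation is solved globally by a weighted contraction
(`exists_average_eq`), and the barrier shows that the truncation is never active. The averaged form
also gives the regularity at `ρ = 0`, and strict convexity amounts to
`κ < (1 - ρ κ²) ^ (α / 2)`, which says that the slope increases (`exists_bowl_profile`).
-/

open Filter Topology

/-! ### The equation in non-divergence form -/

/-- The rotation of a planar vector by a right angle. -/
noncomputable def rot (p : Plane) : Plane := !₂[-p 1, p 0]

lemma norm_rot (p : Plane) : ‖rot p‖ = ‖p‖ := by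
  simp [EuclideanSpace.norm_eq, rot, Fin.sum_univ_two, add_comm]

lemma rot_sub (p q : Plane) : rot p - rot q = rot (p - q) := by
  ext i; fin_cases i <;> simp [rot]; ring

/-- The second derivative of `u` at `x` in the direction `ξ`. -/
noncomputable def secondDeriv (u : Plane → ℝ) (x ξ : Plane) : ℝ :=
  inner ℝ (fderiv ℝ (gradient u) x ξ) ξ

/-- The right-hand side of the equation after multiplication by `(1 + |p|²) ^ (3 / 2)`, as a
function of the gradient `p`. -/
noncomputable def slopeTerm (α : ℝ) (p : Plane) : ℝ := √(1 + ‖p‖ ^ 2) ^ 3 * (1 / √(1 + ‖p‖ ^ 2)) ^ α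

/-- The difference of the two sides of the soliton equation multiplied by `(1 + |Du|²) ^ (3 / 2)`.
In the plane the principal part `(1 + |p|²) tr A - ⟨A p, p⟩` is a sum of second derivatives in the
two coordinate directions and in the direction orthogonal to `p = Du`. -/
noncomputable def solitonOp (α : ℝ) (u : Plane → ℝ) (x : Plane) : ℝ :=
  secondDeriv u x (EuclideanSpace.single 0 1) + secondDeriv u x (EuclideanSpace.single 1 1)
    + secondDeriv u x (rot (gradient u x)) - slopeTerm α (gradient u x)

lemma sqrt_one_add_normSq_pos (p : Plane) : 0 < √(1 + ‖p‖ ^ 2) := by positivity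

/-- The divergence of the normalized gradient in non-divergence form. The matrix `D g` need not be
symmetric for this identity. -/
lemma planeDiv_normalized_gradient {g : Plane → Plane} {x : Plane} (hg : DifferentiableAt ℝ g x) :
    √(1 + ‖g x‖ ^ 2) ^ 3 * planeDiv (fun y => (1 / √(1 + ‖g y‖ ^ 2)) • g y) x =
      inner ℝ (fderiv ℝ g x (EuclideanSpace.single 0 1)) (EuclideanSpace.single (0 : Fin 2) (1 : ℝ))
      + inner ℝ (fderiv ℝ g x (EuclideanSpace.single 1 1))
        (EuclideanSpace.single (1 : Fin 2) (1 : ℝ))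
      + inner ℝ (fderiv ℝ g x (rot (g x))) (rot (g x)) := by
  have hA := hg.hasFDerivAt
  set A := fderiv ℝ g x with hAdef
  set W := √(1 + ‖g x‖ ^ 2) with hW
  have hWpos : 0 < W := sqrt_one_add_normSq_pos _
  have hW2 : W ^ 2 = 1 + (g x 0 ^ 2 + g x 1 ^ 2) := by
    rw [hW, Real.sq_sqrt (by positivity), EuclideanSpace.norm_sq_eq]
    simp [Fin.sum_univ_two]
  have hc : ∀ i : Fin 2, HasFDerivAt (fun y => g y i) ((EuclideanSpace.proj i).comp A) x :=
    fun i => ((EuclideanSpace.proj (𝕜 := ℝ) i).hasFDerivAt (x := g x)).comp x hA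
  have hn := hA.norm_sq
  have h1 := (hn.const_add 1).sqrt (by positivity)
  have h2 := (hasDerivAt_inv hWpos.ne').comp_hasFDerivAt x h1
  have key : ∀ i : Fin 2, fderiv ℝ (fun y => ((1 / √(1 + ‖g y‖ ^ 2)) • g y) i) x
      (EuclideanSpace.single i 1) = W⁻¹ * (A (EuclideanSpace.single i 1)) i
        - (W ^ 3)⁻¹ * inner ℝ (g x) (A (EuclideanSpace.single i 1)) * g x i := by
    intro i
    have h3 := h2.mul (hc i)
    have : (fun y => ((1 / √(1 + ‖g y‖ ^ 2)) • g y) i) =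
      (fun y => (√(1 + ‖g y‖ ^ 2))⁻¹ * g y i) := by
      ext y; simp
    rw [this]
    erw [h3.fderiv]
    simp [← hW]
    field_simp
    ring
  have hrot : rot (g x) = (-g x 1) • EuclideanSpace.single (0 : Fin 2) (1 : ℝ)
      + (g x 0) • EuclideanSpace.single (1 : Fin 2) (1 : ℝ) := by
    ext i; fin_cases i <;> simp [rot]
  have hA' : A (rot (g x)) = (-g x 1) • A (EuclideanSpace.single (0 : Fin 2) (1 : ℝ))
      + (g x 0) • A (EuclideanSpace.single (1 : Fin 2) (1 : ℝ)) := by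
    rw [hrot, map_add, map_smul, map_smul]
  rw [hA']
  simp only [planeDiv, Fin.sum_univ_two, key]
  generalize A (EuclideanSpace.single 0 1) = a
  generalize A (EuclideanSpace.single 1 1) = b
  simp only [PiLp.inner_apply, Fin.sum_univ_two, rot]
  simp
  field_simp
  rw [hW2]
  ring

lemma solitonOp_eq_zero {α : ℝ} {u : Plane → ℝ} {x : Plane}
    (hu : DifferentiableAt ℝ (gradient u) x) (h : SolitonEqAt α u x) : solitonOp α u x = 0 := by
  have := planeDiv_normalized_gradient hu
  rw [SolitonEqAt] at h
  rw [h] at this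
  simp only [solitonOp, secondDeriv, ← this, slopeTerm, sub_self]

lemma gradient_comp_add (u : Plane → ℝ) (a : Plane) (c : ℝ) :
    gradient (fun y => u (y + a) + c) = fun y => gradient u (y + a) := by
  ext1 y
  simp [gradient, fderiv_add_const, fderiv_comp_add_right]

lemma solitonOp_comp_add (α : ℝ) (u : Plane → ℝ) (a : Plane) (c : ℝ) (x : Plane) :
    solitonOp α (fun y => u (y + a) + c) x = solitonOp α u (x + a) := by
  simp only [solitonOp, secondDeriv, gradient_comp_add]
  rw [fderiv_comp_add_right (f := gradient u)]

lemma solitonOp_const (α M : ℝ) (x : Plane) : solitonOp α (fun _ => M) x = -1 := by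
  simp [solitonOp, secondDeriv, slopeTerm]

lemma contDiff_slopeTerm (α : ℝ) : ContDiff ℝ 1 (slopeTerm α) := by
  have h : ContDiff ℝ 1 fun p : Plane => √(1 + ‖p‖ ^ 2) :=
    (contDiff_const.add (contDiff_norm_sq ℝ)).sqrt fun p => by positivity
  refine (h.pow 3).mul (ContDiff.rpow_const_of_ne ?_ fun p => ?_)
  · exact contDiff_const.div h fun p => (sqrt_one_add_normSq_pos p).ne'
  · have := sqrt_one_add_normSq_pos p
    positivity

lemma ContDiffOn.contDiffOn_gradient {u : Plane → ℝ} {U : Set Plane} (hU : IsOpen U)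
    (hu : ContDiffOn ℝ 2 u U) : ContDiffOn ℝ 1 (gradient u) U :=
  (InnerProductSpace.toDual ℝ Plane).symm.toContinuousLinearEquiv.contDiff.comp_contDiffOn
    (hu.fderiv_of_isOpen hU (by norm_num))

lemma ContDiffOn.continuousOn_fderiv_gradient {u : Plane → ℝ} {U : Set Plane} (hU : IsOpen U)
    (hu : ContDiffOn ℝ 2 u U) : ContinuousOn (fderiv ℝ (gradient u)) U :=
  (hu.contDiffOn_gradient hU).continuousOn_fderiv_of_isOpen hU le_rfl

/-! ### The comparison principle -/

/-- If the second derivative were positive, the point would also be a local minimum, and the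
function would be locally constant. -/
lemma IsLocalMax.deriv_deriv_nonpos {g : ℝ → ℝ} {t : ℝ} (h : IsLocalMax g t)
    (hc : ContinuousAt g t) : deriv (deriv g) t ≤ 0 := by
  by_contra! hpos
  have hmin := isLocalMin_of_deriv_deriv_pos hpos h.deriv_eq_zero hc
  have heq : g =ᶠ[𝓝 t] fun _ => g t := by
    filter_upwards [h, hmin] with s h1 h2 using le_antisymm h1 h2
  have := heq.deriv.deriv_eq
  simp [this] at hpos

lemma hasDerivAt_line (x ξ : Plane) (t : ℝ) : HasDerivAt (fun s : ℝ => x + s • ξ) ξ t := by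
  simpa using ((hasDerivAt_id t).smul_const ξ).const_add x

/-- The second-derivative test along lines, at a local maximum of `u - v + ε exp (l x₀)`. -/
lemma secondDeriv_le_of_isLocalMax {u v : Plane → ℝ} {U : Set Plane} (hU : IsOpen U)
    (hu : ContDiffOn ℝ 2 u U) (hv : ContDiffOn ℝ 2 v U) {ε l : ℝ} {x : Plane} (hx : x ∈ U)
    (hmax : IsLocalMax (fun y => u y - v y + ε * Real.exp (l * y 0)) x) (ξ : Plane) :
    inner ℝ (gradient u x) ξ - inner ℝ (gradient v x) ξ = -(ε * l * Real.exp (l * x 0)) * ξ 0 ∧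
    secondDeriv u x ξ - secondDeriv v x ξ ≤ -(ε * l ^ 2 * Real.exp (l * x 0)) * ξ 0 ^ 2 := by
  have hline0 : x + (0 : ℝ) • ξ = x := by simp
  have hcont : ContinuousAt (fun s : ℝ => x + s • ξ) 0 := (hasDerivAt_line x ξ 0).continuousAt
  have hmem : ∀ᶠ t in 𝓝 (0 : ℝ), x + t • ξ ∈ U :=
    hcont.eventually_mem (hU.mem_nhds (by simpa using hx))
  have hfirst : ∀ w : Plane → ℝ, ContDiffOn ℝ 2 w U → ∀ t : ℝ, x + t • ξ ∈ U →
      HasDerivAt (fun s : ℝ => w (x + s • ξ)) (inner ℝ (gradient w (x + t • ξ)) ξ) t := by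
    intro w hw t ht
    have hd : DifferentiableAt ℝ w (x + t • ξ) :=
      (hw.contDiffAt (hU.mem_nhds ht)).differentiableAt (by norm_num)
    have := hd.hasFDerivAt.comp_hasDerivAt t (hasDerivAt_line x ξ t)
    rwa [← inner_gradient_left] at this
  have hsecond : ∀ w : Plane → ℝ, ContDiffOn ℝ 2 w U →
      HasDerivAt (fun t : ℝ => inner ℝ (gradient w (x + t • ξ)) ξ) (secondDeriv w x ξ) 0 := by
    intro w hw
    have hd : DifferentiableAt ℝ (gradient w) (x + (0 : ℝ) • ξ) := by
      rw [hline0]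
      exact ((hw.contDiffOn_gradient hU).contDiffAt (hU.mem_nhds hx)).differentiableAt (by norm_num)
    have h := hd.hasFDerivAt.comp_hasDerivAt 0 (hasDerivAt_line x ξ 0)
    have := h.inner ℝ (hasDerivAt_const (0 : ℝ) ξ)
    simpa [secondDeriv, hline0] using this
  have hco : ∀ t : ℝ, HasDerivAt (fun s : ℝ => l * (x + s • ξ) 0) (l * ξ 0) t := by
    intro t
    have : HasDerivAt (fun s : ℝ => l * (x 0 + s * ξ 0)) (l * (1 * ξ 0)) t :=
      (((hasDerivAt_id t).mul_const (ξ 0)).const_add (x 0)).const_mul l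
    simpa using this
  set g : ℝ → ℝ := fun s =>
    u (x + s • ξ) - v (x + s • ξ) + ε * Real.exp (l * (x + s • ξ) 0) with hg
  have hg1 : ∀ t, x + t • ξ ∈ U → HasDerivAt g (inner ℝ (gradient u (x + t • ξ)) ξ
      - inner ℝ (gradient v (x + t • ξ)) ξ
      + ε * (Real.exp (l * (x + t • ξ) 0) * (l * ξ 0))) t := fun t ht =>
    ((hfirst u hu t ht).sub (hfirst v hv t ht)).add ((hco t).exp.const_mul ε)
  have hg2 : HasDerivAt (deriv g) (secondDeriv u x ξ - secondDeriv v x ξ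
      + ε * (Real.exp (l * (x + (0 : ℝ) • ξ) 0) * (l * ξ 0) * (l * ξ 0))) 0 := by
    refine HasDerivAt.congr_of_eventuallyEq (((hsecond u hu).sub (hsecond v hv)).add
      (((hco 0).exp.mul_const (l * ξ 0)).const_mul ε)) ?_
    filter_upwards [hmem] with t ht using (hg1 t ht).deriv
  have hmax' : IsLocalMax g 0 := by
    have : IsLocalMax (fun y => u y - v y + ε * Real.exp (l * y 0)) (x + (0 : ℝ) • ξ) := by
      rwa [hline0]
    exact hcont.eventually this
  have h0 := hg1 0 (by simpa using hx)
  constructor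
  · have := h0.deriv.symm.trans hmax'.deriv_eq_zero
    rw [hline0] at this
    linarith
  · have := hmax'.deriv_deriv_nonpos h0.continuousAt
    rw [hg2.deriv, hline0] at this
    linarith

/-- A quadratic form is Lipschitz on bounded sets; applied to `rot Du` and `rot Dv`, this controls
the principal part of the equation under a change of the gradient. -/
lemma abs_inner_sub_inner_le (A : Plane →L[ℝ] Plane) (a b : Plane) :
    |inner ℝ (A a) a - inner ℝ (A b) b| ≤ ‖A‖ * (‖a‖ + ‖b‖) * ‖a - b‖ := by
  have h : inner ℝ (A a) a - inner ℝ (A b) b = inner ℝ (A (a - b)) a + inner ℝ (A b) (a - b) := by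
    rw [map_sub, inner_sub_left, inner_sub_right]; ring
  rw [h]
  have h1 := (abs_real_inner_le_norm (A (a - b)) a).trans
    (mul_le_mul_of_nonneg_right (A.le_opNorm (a - b)) (norm_nonneg a))
  have h2 := (abs_real_inner_le_norm (A b) (a - b)).trans
    (mul_le_mul_of_nonneg_right (A.le_opNorm b) (norm_nonneg (a - b)))
  calc _ ≤ _ := abs_add_le _ _
    _ ≤ _ := add_le_add h1 h2
    _ = _ := by ring

/-- The comparison principle: a subsolution which lies below a supersolution on the boundary of a
bounded open set lies below it everywhere. -/
theorem le_of_solitonOp_le {α : ℝ} {U : Set Plane} (hU : IsOpen U) (hb : Bornology.IsBounded U)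
    {u v : Plane → ℝ} (hu : ContDiffOn ℝ 2 u U) (hv : ContDiffOn ℝ 2 v U)
    (huc : ContinuousOn u (closure U)) (hvc : ContinuousOn v (closure U))
    (hop : ∀ x ∈ U, solitonOp α v x ≤ solitonOp α u x)
    (hbd : ∀ x ∈ frontier U, u x ≤ v x) : ∀ x ∈ closure U, u x ≤ v x := by
  by_contra! hcon
  obtain ⟨z, hz, hzuv⟩ := hcon
  have hcpt : IsCompact (closure U) := hb.isCompact_closure
  have hwc : ContinuousOn (fun x => u x - v x) (closure U) := huc.sub hvc
  set M := u z - v z with hM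
  have hMpos : 0 < M := sub_pos.2 hzuv
  -- on the superlevel set `K`, a compact subset of `U`, all derivatives are bounded
  set K : Set Plane := closure U ∩ (fun x => u x - v x) ⁻¹' Ici (M / 2) with hK
  have hKcpt : IsCompact K :=
    hcpt.of_isClosed_subset (hwc.preimage_isClosed_of_isClosed isClosed_closure isClosed_Ici)
      inter_subset_left
  have hKU : K ⊆ U := by
    rintro x ⟨hx, hxM⟩
    by_contra hxU
    have hfr : x ∈ frontier U := by rw [hU.frontier_eq]; exact ⟨hx, hxU⟩
    have := hbd x hfr
    have hxM' : M / 2 ≤ u x - v x := hxM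
    linarith
  obtain ⟨B₁, hB₁⟩ := hKcpt.exists_bound_of_continuousOn
    ((hu.contDiffOn_gradient hU).continuousOn.mono hKU)
  obtain ⟨B₂, hB₂⟩ := hKcpt.exists_bound_of_continuousOn
    ((hv.contDiffOn_gradient hU).continuousOn.mono hKU)
  obtain ⟨B₃, hB₃⟩ := hKcpt.exists_bound_of_continuousOn
    ((hv.continuousOn_fderiv_gradient hU).mono hKU)
  set B := max B₁ B₂
  obtain ⟨L, hL⟩ := ((contDiff_slopeTerm α).locallyLipschitz.locallyLipschitzOn
    (s := closedBall (0 : Plane) B)).exists_lipschitzOnWith_of_compact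
      (isCompact_closedBall 0 B)
  -- `l` exceeds the sum of the Lipschitz constants in the gradient of all remaining terms
  set l := B₃ * (B + B) + L + 1 with hl
  obtain ⟨T, hT⟩ := hcpt.exists_bound_of_continuousOn
    (f := fun x : Plane => Real.exp (l * x 0)) (by fun_prop)
  have hTpos : 0 < T := lt_of_lt_of_le (Real.exp_pos _) ((le_abs_self _).trans (hT z hz))
  -- the perturbation is at most `M / 4`, so that the perturbed maximum is attained in `K`
  set ε := M / (4 * T) with hε
  have hεpos : 0 < ε := by positivity
  obtain ⟨x, hxU, hxmax⟩ := hcpt.exists_isMaxOn ⟨z, hz⟩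
    (f := fun y => u y - v y + ε * Real.exp (l * y 0)) (hwc.add (by fun_prop))
  have hxK : x ∈ K := by
    refine ⟨hxU, ?_⟩
    have h1 : u z - v z + ε * Real.exp (l * z 0) ≤ u x - v x + ε * Real.exp (l * x 0) := hxmax hz
    have h2 : ε * Real.exp (l * x 0) ≤ ε * T :=
      mul_le_mul_of_nonneg_left ((le_abs_self _).trans (hT x hxU)) hεpos.le
    have h3 : ε * T = M / 4 := by rw [hε]; field_simp
    have h4 := mul_pos hεpos (Real.exp_pos (l * z 0))
    change M / 2 ≤ u x - v x
    linarith
  have hxU' := hKU hxK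
  have hmax := hxmax.isLocalMax (mem_of_superset (hU.mem_nhds hxU') subset_closure)
  have hder := secondDeriv_le_of_isLocalMax hU hu hv hxU' hmax
  have hB3nn : 0 ≤ B₃ := (norm_nonneg _).trans (hB₃ x hxK)
  have hBnn : 0 ≤ B := (norm_nonneg _).trans ((hB₁ x hxK).trans (le_max_left _ _))
  have hlpos : 0 < l := by positivity
  set p := gradient u x with hp
  set q := gradient v x with hq
  set η := ε * l * Real.exp (l * x 0) with hη
  have hηpos : 0 < η := by positivity
  -- `Du - Dv` is a small multiple of the first basis vector, of length `η`
  have hpq : ‖p - q‖ = η := by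
    have : p - q = (-η) • EuclideanSpace.single (0 : Fin 2) (1 : ℝ) := by
      refine ext_inner_right ℝ fun ξ => ?_
      rw [inner_sub_left, (hder ξ).1, inner_smul_left]
      simp [EuclideanSpace.inner_single_left]
    rw [this, norm_smul]
    simp [abs_of_pos hηpos]
  have hd0 := (hder (EuclideanSpace.single 0 1)).2
  have hd1 := (hder (EuclideanSpace.single 1 1)).2
  have hd2 := (hder (rot p)).2
  simp only [PiLp.single_apply, if_true, one_pow, mul_one] at hd0
  simp only [PiLp.single_apply, zero_ne_one, if_false] at hd1
  have hd2' : secondDeriv u x (rot p) - secondDeriv v x (rot p) ≤ 0 := by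
    refine hd2.trans ?_
    have : 0 ≤ ε * l ^ 2 * Real.exp (l * x 0) * (rot p).ofLp 0 ^ 2 := by positivity
    linarith
  have hquad : secondDeriv v x (rot p) - secondDeriv v x (rot q) ≤ B₃ * (B + B) * η := by
    refine (le_abs_self _).trans ((abs_inner_sub_inner_le _ _ _).trans ?_)
    rw [rot_sub, norm_rot, norm_rot, norm_rot, hpq]
    have h1 : ‖p‖ ≤ B := (hB₁ x hxK).trans (le_max_left _ _)
    have h2 : ‖q‖ ≤ B := (hB₂ x hxK).trans (le_max_right _ _)
    have h3 := hB₃ x hxK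
    gcongr
  have hslope : slopeTerm α q - slopeTerm α p ≤ L * η := by
    have h := hL.dist_le_mul q (mem_closedBall_zero_iff.2 ((hB₂ x hxK).trans (le_max_right _ _))) p
      (mem_closedBall_zero_iff.2 ((hB₁ x hxK).trans (le_max_left _ _)))
    rw [Real.dist_eq, dist_comm, dist_eq_norm, hpq] at h
    exact (le_abs_self _).trans h
  have hfin := hop x hxU'
  simp only [solitonOp, ← hp, ← hq] at hfin
  have hd0' : ε * l ^ 2 * Real.exp (l * x 0) = l * η := by rw [hη]; ring
  rw [hd0', hl] at hd0
  nlinarith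

/-! ### Estimates for solutions of the Dirichlet problem -/

lemma frontier_nonempty_of_isBounded {Ω : Set Plane} (hne : Ω.Nonempty)
    (hb : Bornology.IsBounded Ω) : (frontier Ω).Nonempty := by
  rw [nonempty_iff_ne_empty, Ne, frontier_eq_empty_iff]
  rintro (h | h)
  · exact hne.ne_empty h
  · rw [h] at hb
    exact NormedSpace.unbounded_univ ℝ Plane hb

lemma IsDirichletSolution.solitonOp_eq_zero {α : ℝ} {Ω : Set Plane} {φ u : Plane → ℝ}
    (hΩ : IsOpen Ω) (hu : IsDirichletSolution α Ω φ u) {x : Plane} (hx : x ∈ Ω) :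
    solitonOp α u x = 0 :=
  _root_.solitonOp_eq_zero (((hu.regular.contDiffOn.contDiffOn_gradient hΩ).contDiffAt
    (hΩ.mem_nhds hx)).differentiableAt (by norm_num)) (hu.equation x hx)

theorem IsDirichletSolution.eqOn {α : ℝ} {Ω : Set Plane} {φ u v : Plane → ℝ}
    (hΩ : IsOpen Ω) (hb : Bornology.IsBounded Ω) (hu : IsDirichletSolution α Ω φ u)
    (hv : IsDirichletSolution α Ω φ v) : EqOn u v (closure Ω) := by
  have key : ∀ {u v : Plane → ℝ}, IsDirichletSolution α Ω φ u → IsDirichletSolution α Ω φ v →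
      ∀ x ∈ closure Ω, u x ≤ v x := fun {u v} hu hv =>
    le_of_solitonOp_le hΩ hb hu.regular.contDiffOn hv.regular.contDiffOn
      hu.regular.continuousOn hv.regular.continuousOn
      (fun x hx => by rw [hu.solitonOp_eq_zero hΩ hx, hv.solitonOp_eq_zero hΩ hx])
      (fun x hx => by rw [hu.boundary x hx, hv.boundary x hx])
  exact fun x hx => le_antisymm (key hu hv x hx) (key hv hu x hx)

/-- Constants are supersolutions. -/
theorem IsDirichletSolution.le_of_frontier {α : ℝ} {Ω : Set Plane} {φ u : Plane → ℝ} {M : ℝ}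
    (hΩ : IsOpen Ω) (hb : Bornology.IsBounded Ω) (hu : IsDirichletSolution α Ω φ u)
    (hM : ∀ x ∈ frontier Ω, φ x ≤ M) : ∀ x ∈ closure Ω, u x ≤ M :=
  le_of_solitonOp_le (v := fun _ => M) hΩ hb hu.regular.contDiffOn contDiffOn_const
    hu.regular.continuousOn continuousOn_const
    (fun x hx => by rw [hu.solitonOp_eq_zero hΩ hx, solitonOp_const]; norm_num)
    (fun x hx => by rw [hu.boundary x hx]; exact hM x hx)

lemma IsBowlSoliton.nonpos_of_norm_le {α R : ℝ} {b : Plane → ℝ} (hb : IsBowlSoliton α b)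
    (hR : 0 < R) (h0 : ∀ y, ‖y‖ = R → b y = 0) {y : Plane} (hy : ‖y‖ ≤ R) : b y ≤ 0 := by
  obtain ⟨z, hz, hyz⟩ : ∃ z : Plane, ‖z‖ = R ∧ y ∈ segment ℝ 0 z := by
    rcases eq_or_ne y 0 with rfl | hy0
    · exact ⟨EuclideanSpace.single 0 R, by simp [abs_of_pos hR], left_mem_segment _ _ _⟩
    · have hyn : 0 < ‖y‖ := norm_pos_iff.2 hy0
      refine ⟨(R / ‖y‖) • y, ?_, ?_⟩
      · rw [norm_smul, Real.norm_of_nonneg (by positivity)]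
        field_simp
      · rw [segment_eq_image]
        refine ⟨‖y‖ / R, ⟨by positivity, (div_le_one hR).2 hy⟩, ?_⟩
        simp only [smul_zero, zero_add, smul_smul]
        rw [show ‖y‖ / R * (R / ‖y‖) = 1 by field_simp, one_smul]
  have := hb.strictConvex.convexOn.le_max_of_mem_segment (mem_univ _) (mem_univ _) hyz
  rwa [max_eq_right (hb.minimum z), h0 z hz] at this

theorem IsDirichletSolution.bowl_le {α : ℝ} {Ω : Set Plane} {φ u b : Plane → ℝ} {m R : ℝ}
    {p : Plane} (hΩ : IsOpen Ω) (hbd : Bornology.IsBounded Ω) (hu : IsDirichletSolution α Ω φ u)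
    (hR : 0 < R) (hball : closure Ω ⊆ ball p R) (hm : ∀ x ∈ frontier Ω, m ≤ φ x)
    (hb : IsBowlSoliton α b) (h0 : ∀ y, ‖y‖ = R → b y = 0) : ∀ x ∈ closure Ω, b 0 + m ≤ u x := by
  have hC : ContDiff ℝ 2 fun y => b (y + -p) + m :=
    (hb.contDiff.comp (contDiff_id.add contDiff_const)).add contDiff_const
  have hgrad : ∀ x, DifferentiableAt ℝ (gradient b) x := fun x =>
    ((hb.contDiff.contDiffOn.contDiffOn_gradient isOpen_univ).contDiffAt univ_mem).differentiableAt
      (by norm_num)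
  intro x hx
  refine (add_le_add_left (hb.minimum (x + -p)) m).trans ?_
  refine le_of_solitonOp_le (α := α) (u := fun y => b (y + -p) + m) hΩ hbd hC.contDiffOn
    hu.regular.contDiffOn hC.continuous.continuousOn hu.regular.continuousOn
    (fun y hy => ?_) (fun y hy => ?_) x hx
  · rw [hu.solitonOp_eq_zero hΩ hy, solitonOp_comp_add,
      _root_.solitonOp_eq_zero (hgrad _) (hb.equation _)]
  · have hyb := hball (frontier_subset_closure hy)
    rw [mem_ball, dist_eq_norm] at hyb
    have := hb.nonpos_of_norm_le hR h0 (y := y + -p) (by rw [← sub_eq_add_neg]; exact hyb.le)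
    rw [hu.boundary y hy]
    linarith [hm y hy]

/-! ### The maximum of the gradient -/

/-- Difference quotients of a `C¹` function converge uniformly on compact subsets. -/
lemma exists_uniform_differenceQuotient {Ω C : Set Plane} (hΩ : IsOpen Ω) (hC : IsCompact C)
    (hCΩ : C ⊆ Ω) {u : Plane → ℝ} (hu : DifferentiableOn ℝ u Ω)
    (hg : ContinuousOn (gradient u) Ω) {e : Plane} (he : ‖e‖ = 1) {ε : ℝ} (hε : 0 < ε) :
    ∃ h > 0, ∀ x ∈ C, x + h • e ∈ Ω ∧
      |u (x + h • e) - u x - h * inner ℝ (gradient u x) e| ≤ h * ε := by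
  obtain ⟨δ, hδ, hδΩ⟩ := hC.exists_cthickening_subset_open hΩ hCΩ
  have huc : UniformContinuousOn (gradient u) (cthickening δ C) :=
    hC.cthickening.uniformContinuousOn_of_continuous (hg.mono hδΩ)
  obtain ⟨δ', hδ', hδ'u⟩ := Metric.uniformContinuousOn_iff.1 huc ε hε
  refine ⟨min δ (δ' / 2), lt_min hδ (by positivity), fun x hx => ?_⟩
  set h := min δ (δ' / 2) with hh
  have hpos : 0 < h := lt_min hδ (by positivity)
  have hdist : ∀ t ∈ Icc 0 h, dist (x + t • e) x = t := fun t ht => by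
    rw [dist_eq_norm, add_sub_cancel_left, norm_smul, he, mul_one, Real.norm_of_nonneg ht.1]
  have hmem : ∀ t ∈ Icc 0 h, x + t • e ∈ cthickening δ C := fun t ht =>
    mem_cthickening_of_dist_le _ x _ _ hx (by
      rw [hdist t ht]; exact ht.2.trans (min_le_left _ _))
  have hder : ∀ t ∈ Icc 0 h,
      HasDerivAt (fun s : ℝ => u (x + s • e)) (inner ℝ (gradient u (x + t • e)) e) t := by
    intro t ht
    have hd := (hu _ (hδΩ (hmem t ht))).differentiableAt (hΩ.mem_nhds (hδΩ (hmem t ht)))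
    have := hd.hasFDerivAt.comp_hasDerivAt t (hasDerivAt_line x e t)
    rwa [← inner_gradient_left] at this
  obtain ⟨c, hc, hcs⟩ := exists_hasDerivAt_eq_slope (fun s : ℝ => u (x + s • e))
    (fun t => inner ℝ (gradient u (x + t • e)) e) hpos
    (fun t ht => (hder t ht).continuousAt.continuousWithinAt)
    (fun t ht => hder t (Ioo_subset_Icc_self ht))
  refine ⟨hδΩ (hmem h ⟨hpos.le, le_rfl⟩), ?_⟩
  have hc' := Ioo_subset_Icc_self hc
  have hx0 : x ∈ cthickening δ C := self_subset_cthickening _ hx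
  have hlt : dist (x + c • e) x < δ' := by
    rw [hdist c hc']
    have := min_le_right δ (δ' / 2)
    linarith [hc.2]
  have hclose := hδ'u _ (hmem c hc') _ hx0 hlt
  simp only [zero_smul, add_zero, sub_zero] at hcs
  rw [eq_div_iff hpos.ne'] at hcs
  rw [← hcs, mul_comm _ h, ← mul_sub, abs_mul, abs_of_pos hpos, ← inner_sub_left]
  refine mul_le_mul_of_nonneg_left ?_ hpos.le
  refine (abs_real_inner_le_norm _ _).trans ?_
  rw [he, mul_one, ← dist_eq_norm]
  exact hclose.le

lemma continuousOn_closureGradient_and_eqOn {Ω : Set Plane} {u : Plane → ℝ}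
    (hu : IsC2UpToBoundary Ω u) :
    ContinuousOn (closureGradient Ω u) (closure Ω) ∧ EqOn (closureGradient Ω u) (gradient u) Ω := by
  obtain ⟨G, hGc, hGe⟩ := hu.gradient_extends
  have heq : EqOn (closureGradient Ω u) G (closure Ω) := fun x hx =>
    extendFrom_eq hx (((hGc x hx).mono subset_closure).tendsto.congr'
      (eventually_nhdsWithin_of_forall hGe))
  exact ⟨hGc.congr heq, fun x hx => (heq (subset_closure hx)).trans (hGe hx)⟩

/-- A bound for the gradient on the boundary holds in `Ω`. If `K = |Du(x₀)|` were larger, take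
`e = Du(x₀) / K`: a superlevel set of the derivative of `u` along `e` contains `x₀` and has its
closure in `Ω`. Comparing `u` there with its small translates along `e` gives a contradiction. -/
theorem IsDirichletSolution.norm_closureGradient_le {α : ℝ} {Ω : Set Plane} {φ u : Plane → ℝ}
    (hΩ : IsOpen Ω) (hb : Bornology.IsBounded Ω) (hu : IsDirichletSolution α Ω φ u) {K' : ℝ}
    (hK' : ∀ x ∈ frontier Ω, ‖closureGradient Ω u x‖ ≤ K') {x₀ : Plane} (hx₀ : x₀ ∈ closure Ω) :
    ‖closureGradient Ω u x₀‖ ≤ K' := by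
  by_contra! hlt
  obtain ⟨hcont, heq⟩ := continuousOn_closureGradient_and_eqOn hu.regular
  have hx₀Ω : x₀ ∈ Ω := by
    by_contra hn
    exact absurd (hK' x₀ (by rw [hΩ.frontier_eq]; exact ⟨hx₀, hn⟩)) (not_le.2 hlt)
  set K := ‖closureGradient Ω u x₀‖ with hK
  have hKK' : max K' 0 < K := by
    refine max_lt hlt ?_
    by_contra! h0
    obtain ⟨y, hy⟩ := frontier_nonempty_of_isBounded ⟨x₀, hx₀Ω⟩ hb
    linarith [hK' y hy, norm_nonneg (closureGradient Ω u y)]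
  have hKpos : 0 < K := lt_of_le_of_lt (le_max_right _ _) hKK'
  have hgx₀ : ‖gradient u x₀‖ = K := by rw [← heq hx₀Ω]
  set e := K⁻¹ • gradient u x₀ with he_def
  have he : ‖e‖ = 1 := by
    rw [he_def, norm_smul, hgx₀, Real.norm_of_nonneg (by positivity)]; field_simp
  have hex₀ : inner ℝ (gradient u x₀) e = K := by
    rw [he_def, inner_smul_right, real_inner_self_eq_norm_sq, hgx₀]; field_simp
  set ε := (K - K') / 2 with hε
  have hεpos : 0 < ε := by rw [hε]; linarith
  have hgc : ContinuousOn (gradient u) Ω :=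
    (hu.regular.contDiffOn.contDiffOn_gradient hΩ).continuousOn
  set U : Set Plane := Ω ∩ (fun x => inner ℝ (gradient u x) e) ⁻¹' Ioi (K - ε) with hU
  have hUo : IsOpen U :=
    (hgc.inner continuousOn_const).isOpen_inter_preimage hΩ isOpen_Ioi
  have hUb : Bornology.IsBounded U := hb.subset inter_subset_left
  have hclU : closure U ⊆ Ω := by
    set F : Set Plane := closure Ω ∩ (fun x => inner ℝ (closureGradient Ω u x) e) ⁻¹' Ici (K - ε)
    have hF : IsClosed F :=
      (hcont.inner continuousOn_const).preimage_isClosed_of_isClosed isClosed_closure isClosed_Ici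
    have hUF : U ⊆ F := fun x hx => ⟨subset_closure hx.1, by
      have h := hx.2
      simp only [mem_preimage, mem_Ioi, mem_Ici] at h ⊢
      rw [heq hx.1]; exact h.le⟩
    intro x hx
    obtain ⟨hx1, hx2⟩ := closure_minimal hUF hF hx
    by_contra hn
    have h1 := hK' x (by rw [hΩ.frontier_eq]; exact ⟨hx1, hn⟩)
    have h2 := real_inner_le_norm (closureGradient Ω u x) e
    have h3 : K - ε ≤ inner ℝ (closureGradient Ω u x) e := hx2
    rw [he, mul_one] at h2
    rw [hε] at h3
    linarith
  obtain ⟨h, hh, hquot⟩ := exists_uniform_differenceQuotient hΩ hUb.isCompact_closure hclU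
    (hu.regular.contDiffOn.differentiableOn (by norm_num)) hgc he (ε := ε / 4) (by positivity)
  have hmaps : MapsTo (fun y : Plane => y + h • e) (closure U) Ω := fun x hx => (hquot x hx).1
  have hcomp := le_of_solitonOp_le (α := α) (u := fun y => u (y + h • e) + -(h * (K - 3 * ε / 4)))
    (v := u) hUo hUb
    ((hu.regular.contDiffOn.comp (contDiff_id.add contDiff_const).contDiffOn
      (hmaps.mono_left subset_closure)).add contDiffOn_const)
    (hu.regular.contDiffOn.mono inter_subset_left)
    ((hu.regular.contDiffOn.continuousOn.comp (by fun_prop) hmaps).add continuousOn_const)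
    (hu.regular.contDiffOn.continuousOn.mono hclU)
    (fun x hx => by
      rw [solitonOp_comp_add, hu.solitonOp_eq_zero hΩ (hmaps (subset_closure hx)),
        hu.solitonOp_eq_zero hΩ hx.1])
    (fun x hx => by
      rw [hUo.frontier_eq] at hx
      have h1 := (abs_le.1 (hquot x hx.1).2).2
      have h2 : inner ℝ (gradient u x) e ≤ K - ε := by
        by_contra! hn
        exact hx.2 ⟨hclU hx.1, hn⟩
      have h3 := mul_le_mul_of_nonneg_left h2 hh.le
      linarith)
    x₀ (subset_closure ⟨hx₀Ω, by
      simp only [mem_preimage, mem_Ioi, hex₀]; linarith⟩)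
  have hlow := (abs_le.1 (hquot x₀ (subset_closure ⟨hx₀Ω, by
      simp only [mem_preimage, mem_Ioi, hex₀]; linarith⟩)).2).1
  rw [hex₀] at hlow
  have := mul_pos hh hεpos
  linarith

/-! ### The averaged integral equation -/

/-- Averages over `[0, ρ]` of a `C¹` function depend on `ρ` in a `C¹` way, also at `ρ = 0`. -/
lemma hasDerivAt_average {F F' : ℝ → ℝ} (hF : ∀ t, HasDerivAt F (F' t) t) (hF' : Continuous F')
    (ρ : ℝ) : HasDerivAt (fun r => ∫ t in (0 : ℝ)..1, F (r * t))
      (∫ t in (0 : ℝ)..1, t * F' (ρ * t)) ρ := by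
  have hFc : Continuous F := continuous_iff_continuousAt.2 fun t => (hF t).continuousAt
  have hcpt : IsCompact (closedBall ρ 1 ×ˢ Icc (0 : ℝ) 1) :=
    (isCompact_closedBall ρ 1).prod isCompact_Icc
  obtain ⟨B, hB⟩ := hcpt.exists_bound_of_continuousOn
    (f := fun q : ℝ × ℝ => q.2 * F' (q.1 * q.2)) (by fun_prop)
  refine (intervalIntegral.hasDerivAt_integral_of_dominated_loc_of_deriv_le
    (F := fun r t => F (r * t)) (F' := fun r t => t * F' (r * t)) (bound := fun _ => B)
    (closedBall_mem_nhds ρ one_pos) ?_ ?_ ?_ ?_ ?_ ?_).2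
  · exact Eventually.of_forall fun r =>
      (by fun_prop : Continuous fun t => F (r * t)).aestronglyMeasurable
  · exact (by fun_prop : Continuous fun t => F (ρ * t)).intervalIntegrable _ _
  · exact (by fun_prop : Continuous fun t => t * F' (ρ * t)).aestronglyMeasurable
  · refine Eventually.of_forall fun t ht r hr => hB (r, t) ⟨hr, ?_⟩
    rw [uIoc_of_le zero_le_one] at ht
    exact ⟨ht.1.le, ht.2⟩
  · exact intervalIntegrable_const
  · refine Eventually.of_forall fun t _ r _ => ?_
    have := (hF (r * t)).comp r ((hasDerivAt_id r).mul_const t)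
    simpa [mul_comm, Function.comp_def] using this

/-- A Volterra equation for averages over `[0, ρ]`. The contraction principle applies globally, in
the space of bounded functions after division by the weight `exp (∫₀^ρ ℓ)`. -/
theorem exists_average_eq {H : ℝ → ℝ → ℝ} (hH : Continuous (Function.uncurry H))
    (hH1 : ∀ η k, |H η k| ≤ 1) {ℓ : ℝ → ℝ} (hℓ : Continuous ℓ) (hℓ0 : ∀ η, 0 ≤ ℓ η)
    (hlip : ∀ η j k, |H η j - H η k| ≤ max η 0 * ℓ η * |j - k|) :
    ∃ κ : ℝ → ℝ, Continuous κ ∧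
      ∀ ρ, κ ρ = (∫ t in (0 : ℝ)..1, H (ρ * t) (κ (ρ * t))) / 2 := by
  set Λ : ℝ → ℝ := fun ρ => ∫ t in (0 : ℝ)..ρ, ℓ t with hΛ
  have hΛd : ∀ ρ, HasDerivAt Λ (ℓ ρ) ρ := fun ρ => hℓ.integral_hasStrictDerivAt 0 ρ |>.hasDerivAt
  have hΛc : Continuous Λ := continuous_iff_continuousAt.2 fun t => (hΛd t).continuousAt
  set E : ℝ → ℝ := fun ρ => Real.exp (Λ (max ρ 0)) with hE
  have hEc : Continuous E := by fun_prop
  have hE1 : ∀ ρ, 1 ≤ E ρ := fun ρ => by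
    rw [hE, Real.one_le_exp_iff]
    exact intervalIntegral.integral_nonneg (le_max_right _ _) fun t _ => hℓ0 t
  have hE0 : ∀ ρ, 0 < E ρ := fun ρ => zero_lt_one.trans_le (hE1 ρ)
  -- the weight is chosen so that the average of the Lipschitz constants against it is at most `E`
  have hweight : ∀ ρ, ∫ t in (0 : ℝ)..1, max (ρ * t) 0 * ℓ (ρ * t) * E (ρ * t) ≤ E ρ := by
    intro ρ
    rcases le_or_gt ρ 0 with hρ | hρ
    · have : ∫ t in (0 : ℝ)..1, max (ρ * t) 0 * ℓ (ρ * t) * E (ρ * t) = ∫ t in (0 : ℝ)..1, 0 := by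
        refine intervalIntegral.integral_congr fun t ht => ?_
        rw [uIcc_of_le zero_le_one] at ht
        simp [max_eq_right (mul_nonpos_of_nonpos_of_nonneg hρ ht.1)]
      rw [this]
      simpa using (hE0 ρ).le
    · calc ∫ t in (0 : ℝ)..1, max (ρ * t) 0 * ℓ (ρ * t) * E (ρ * t)
          ≤ ∫ t in (0 : ℝ)..1, ρ * (ℓ (ρ * t) * Real.exp (Λ (ρ * t))) := by
            refine intervalIntegral.integral_mono_on zero_le_one
              (Continuous.intervalIntegrable (by fun_prop) _ _)
              (Continuous.intervalIntegrable (by fun_prop) _ _) fun t ht => ?_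
            have hρt : 0 ≤ ρ * t := mul_nonneg hρ.le ht.1
            simp only [hE, max_eq_left hρt]
            rw [mul_assoc]
            refine mul_le_mul_of_nonneg_right (mul_le_of_le_one_right hρ.le ht.2) ?_
            exact mul_nonneg (hℓ0 _) (Real.exp_pos _).le
        _ = ∫ t in (0 : ℝ)..ρ, ℓ t * Real.exp (Λ t) := by
            rw [intervalIntegral.integral_const_mul,
              intervalIntegral.mul_integral_comp_mul_left (f := fun t => ℓ t * Real.exp (Λ t))]
            simp
        _ = Real.exp (Λ ρ) - Real.exp (Λ 0) := by
            refine intervalIntegral.integral_eq_sub_of_hasDerivAt (f := fun t => Real.exp (Λ t))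
              (fun t _ => ?_) (Continuous.intervalIntegrable (by fun_prop) _ _)
            rw [mul_comm]
            exact (hΛd t).exp
        _ ≤ E ρ := by
            simp only [hE, max_eq_left hρ.le]
            linarith [Real.exp_pos (Λ 0)]
  have hHc : ∀ f : ℝ → ℝ, Continuous f → Continuous fun η => H η (f η) := fun f hf =>
    hH.comp (continuous_id.prodMk hf)
  let T : (BoundedContinuousFunction ℝ ℝ) → (BoundedContinuousFunction ℝ ℝ) := fun σ =>
    BoundedContinuousFunction.ofNormedAddCommGroup
      (fun ρ => (E ρ)⁻¹ * ((∫ t in (0 : ℝ)..1, H (ρ * t) (E (ρ * t) * σ (ρ * t))) / 2))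
      (by
        have h1 : Continuous fun η => H η (E η * σ η) := hHc _ (by fun_prop)
        have h2 : Continuous fun ρ => ∫ t in (0 : ℝ)..1, H (ρ * t) (E (ρ * t) * σ (ρ * t)) :=
          intervalIntegral.continuous_parametric_intervalIntegral_of_continuous'
            (f := fun ρ t => H (ρ * t) (E (ρ * t) * σ (ρ * t)))
            (h1.comp (continuous_fst.mul continuous_snd)) 0 1
        exact (hEc.inv₀ fun ρ => (hE0 ρ).ne').mul (h2.div_const 2))
      1 (fun ρ => by
        have h1 : ‖∫ t in (0 : ℝ)..1, H (ρ * t) (E (ρ * t) * σ (ρ * t))‖ ≤ 1 * |1 - 0| :=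
          intervalIntegral.norm_integral_le_of_norm_le_const fun t _ => hH1 _ _
        have h2 : (E ρ)⁻¹ ≤ 1 := inv_le_one_of_one_le₀ (hE1 ρ)
        have h3 : 0 < (E ρ)⁻¹ := inv_pos.2 (hE0 ρ)
        rw [norm_mul, norm_div, Real.norm_of_nonneg h3.le]
        simp only [Real.norm_ofNat, sub_zero, abs_one, mul_one] at h1 ⊢
        nlinarith [norm_nonneg (∫ t in (0 : ℝ)..1, H (ρ * t) (E (ρ * t) * σ (ρ * t)))])
  have hT : ContractingWith (1 / 2) T := by
    refine ⟨by rw [← NNReal.coe_lt_coe]; norm_num, LipschitzWith.of_dist_le_mul fun σ τ => ?_⟩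
    rw [BoundedContinuousFunction.dist_le (by positivity)]
    intro ρ
    have hσc : Continuous fun η => H η (E η * σ η) := hHc _ (by fun_prop)
    have hτc : Continuous fun η => H η (E η * τ η) := hHc _ (by fun_prop)
    have hσi : Continuous fun t => H (ρ * t) (E (ρ * t) * σ (ρ * t)) :=
      hσc.comp (continuous_const.mul continuous_id)
    have hτi : Continuous fun t => H (ρ * t) (E (ρ * t) * τ (ρ * t)) :=
      hτc.comp (continuous_const.mul continuous_id)
    have hdiff : |(∫ t in (0 : ℝ)..1, H (ρ * t) (E (ρ * t) * σ (ρ * t)))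
        - ∫ t in (0 : ℝ)..1, H (ρ * t) (E (ρ * t) * τ (ρ * t))| ≤ E ρ * dist σ τ := by
      rw [← intervalIntegral.integral_sub (hσi.intervalIntegrable _ _)
        (hτi.intervalIntegrable _ _)]
      refine (intervalIntegral.abs_integral_le_integral_abs zero_le_one).trans ?_
      calc ∫ t in (0 : ℝ)..1, |H (ρ * t) (E (ρ * t) * σ (ρ * t))
            - H (ρ * t) (E (ρ * t) * τ (ρ * t))|
          ≤ ∫ t in (0 : ℝ)..1, max (ρ * t) 0 * ℓ (ρ * t) * E (ρ * t) * dist σ τ := by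
            refine intervalIntegral.integral_mono_on zero_le_one
              ((hσi.sub hτi).abs.intervalIntegrable _ _)
              (Continuous.intervalIntegrable (by fun_prop) _ _) fun t _ => ?_
            refine (hlip _ _ _).trans ?_
            rw [← mul_sub, abs_mul, abs_of_pos (hE0 _), mul_assoc (_ * _)]
            refine mul_le_mul_of_nonneg_left ?_ (mul_nonneg (le_max_right _ _) (hℓ0 _))
            exact mul_le_mul_of_nonneg_left
              (BoundedContinuousFunction.dist_coe_le_dist (f := σ) (g := τ) _)
              (hE0 _).le
        _ = (∫ t in (0 : ℝ)..1, max (ρ * t) 0 * ℓ (ρ * t) * E (ρ * t)) * dist σ τ :=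
            intervalIntegral.integral_mul_const _ _
        _ ≤ E ρ * dist σ τ := mul_le_mul_of_nonneg_right (hweight ρ) dist_nonneg
    change |(E ρ)⁻¹ * (_ / 2) - (E ρ)⁻¹ * (_ / 2)| ≤ _
    rw [← mul_sub, ← sub_div, abs_mul, abs_div, abs_of_pos (inv_pos.2 (hE0 ρ))]
    calc _ ≤ (E ρ)⁻¹ * (E ρ * dist σ τ / |2|) := by
          have := (inv_pos.2 (hE0 ρ)).le
          gcongr
      _ = _ := by
          have := (hE0 ρ).ne'
          rw [abs_two]; push_cast; field_simp
  obtain ⟨σ, hσ, -⟩ := hT.exists_fixedPoint 0 (edist_ne_top _ _)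
  refine ⟨fun ρ => E ρ * σ ρ, by fun_prop, fun ρ => ?_⟩
  have h := DFunLike.congr_fun hσ ρ
  change (E ρ)⁻¹ * ((∫ t in (0 : ℝ)..1, H (ρ * t) (E (ρ * t) * σ (ρ * t))) / 2) = σ ρ at h
  dsimp only
  rw [← h, mul_inv_cancel_left₀ (hE0 ρ).ne']

/-! ### The profile of the bowl soliton -/

/-- A continuous barrier `δ`: the truncation below uses that `1 - s²` cannot drop to `δ` for the
sine `s` of the slope angle of the profile at radius `√η`. -/
lemma exists_barrier {α : ℝ} (hα : 0 < α) : ∃ δ : ℝ → ℝ, Continuous δ ∧ Antitone δ ∧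
    (∀ η, 0 < δ η) ∧ (∀ η, δ η ≤ 1 / 2) ∧ ∀ η, 0 ≤ η → δ η ^ α * η < 1 - δ η := by
  -- `δ η = c (1 + η) ^ (-1 / α)`, with `c` such that `c ^ α ≤ 1 / 2 ≤ 1 - c`
  set c : ℝ := min (1 / 2) ((1 / 2) ^ (1 / α)) with hc
  have hc0 : 0 < c := lt_min (by norm_num) (by positivity)
  have hc1 : c ≤ 1 / 2 := min_le_left _ _
  have hcα : c ^ α ≤ 1 / 2 := by
    calc c ^ α ≤ ((1 / 2 : ℝ) ^ (1 / α)) ^ α :=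
          Real.rpow_le_rpow hc0.le (min_le_right _ _) hα.le
      _ = 1 / 2 := by rw [← Real.rpow_mul (by norm_num), one_div_mul_cancel hα.ne', Real.rpow_one]
  have hbase : ∀ η : ℝ, 1 ≤ 1 + max η 0 := fun η => by linarith [le_max_right η 0]
  have hpos : ∀ η : ℝ, 0 < (1 + max η 0) ^ (-(1 / α)) := fun η =>
    Real.rpow_pos_of_pos (by linarith [hbase η]) _
  have hle : ∀ η : ℝ, c * (1 + max η 0) ^ (-(1 / α)) ≤ 1 / 2 := fun η => by
    have : (1 + max η 0) ^ (-(1 / α)) ≤ 1 :=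
      Real.rpow_le_one_of_one_le_of_nonpos (hbase η) (by simp [hα.le])
    nlinarith [hpos η]
  refine ⟨fun η => c * (1 + max η 0) ^ (-(1 / α)), ?_, ?_, fun η => mul_pos hc0 (hpos η), hle,
    fun η hη => ?_⟩
  · refine continuous_const.mul (Continuous.rpow_const (by fun_prop) fun η => Or.inl ?_)
    linarith [hbase η]
  · intro η ζ h
    refine mul_le_mul_of_nonneg_left ?_ hc0.le
    refine Real.rpow_le_rpow_of_nonpos (by linarith [hbase η]) ?_ (by simp [hα.le])
    gcongr
  · have h1 : (c * (1 + max η 0) ^ (-(1 / α))) ^ α * η = c ^ α * (η / (1 + η)) := by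
      rw [max_eq_left hη, Real.mul_rpow hc0.le (by positivity), ← Real.rpow_mul (by positivity),
        neg_mul, one_div_mul_cancel hα.ne', Real.rpow_neg_one]
      ring
    have h2 : η / (1 + η) < 1 := (div_lt_one (by linarith)).2 (by linarith)
    have h3 : 0 < c ^ α := Real.rpow_pos_of_pos hc0 _
    dsimp only
    rw [h1]
    nlinarith [hle η]

lemma abs_rpow_sub_rpow_le {a δ y z : ℝ} (ha : 0 < a) (hδ : 0 < δ) (hy : y ∈ Icc δ 1)
    (hz : z ∈ Icc δ 1) : |y ^ a - z ^ a| ≤ a / δ * |y - z| := by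
  refine (convex_Icc δ 1).norm_image_sub_le_of_norm_hasDerivWithin_le (f := fun t => t ^ a)
    (f' := fun t => a * t ^ (a - 1)) (fun t ht => ?_) (fun t ht => ?_) hz hy
  · exact (Real.hasDerivAt_rpow_const (Or.inl (hδ.trans_le ht.1).ne')).hasDerivWithinAt
  · have ht0 : 0 < t := hδ.trans_le ht.1
    have h1 : t ^ a ≤ 1 := Real.rpow_le_one ht0.le ht.2 ha.le
    rw [Real.rpow_sub_one ht0.ne', Real.norm_of_nonneg (by positivity), div_eq_mul_one_div a δ]
    refine mul_le_mul_of_nonneg_left ?_ ha.le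
    exact div_le_div₀ zero_le_one h1 hδ ht.1

/-- The truncated equation has a global solution. For `ρ < 0` it is continued by
`κ = Φ / 2 = 1 / 2`, through `max ρ 0`. -/
lemma exists_truncated_profile {a : ℝ} (ha : 0 < a) {δ : ℝ → ℝ} (hδc : Continuous δ)
    (hδ0 : ∀ η, 0 < δ η) (hδ1 : ∀ η, δ η ≤ 1 / 2) :
    ∃ κ Φ : ℝ → ℝ, Continuous κ ∧ Continuous Φ ∧ (∀ ρ, 0 < κ ρ) ∧
      (∀ ρ, Φ ρ = max (1 - max ρ 0 * κ ρ ^ 2) (δ ρ) ^ a) ∧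
      ∀ ρ, κ ρ = (∫ t in (0 : ℝ)..1, Φ (ρ * t)) / 2 := by
  -- besides the base of the power, the unknown is truncated to the a priori range `[0, 1 / 2]`
  set k : ℝ → ℝ := fun j => max (min j (1 / 2)) 0 with hk
  have hk0 : ∀ j, 0 ≤ k j := fun j => le_max_right _ _
  have hk1 : ∀ j, k j ≤ 1 / 2 := fun j => max_le (min_le_right _ _) (by norm_num)
  have hklip : ∀ i j, |k i - k j| ≤ |i - j| := fun i j =>
    (abs_max_sub_max_le_abs _ _ 0).trans
      (by simpa using abs_min_sub_min_le_max i (1 / 2) j (1 / 2))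
  set y : ℝ → ℝ → ℝ := fun η j => max (1 - max η 0 * k j ^ 2) (δ η) with hy
  have hymem : ∀ η j, y η j ∈ Icc (δ η) 1 := fun η j =>
    ⟨le_max_right _ _, max_le (by
      have := mul_nonneg (le_max_right η 0) (sq_nonneg (k j)); linarith) (by linarith [hδ1 η])⟩
  have hypos : ∀ η j, 0 < y η j := fun η j => (hδ0 η).trans_le (hymem η j).1
  have hHc : Continuous (Function.uncurry fun η j => y η j ^ a) := by
    refine Continuous.rpow_const ?_ fun q => Or.inl (hypos _ _).ne'
    simp only [hy, hk]
    fun_prop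
  obtain ⟨κ, hκc, hκ⟩ := exists_average_eq (H := fun η j => y η j ^ a) hHc
    (fun η j => by
      rw [abs_of_nonneg (Real.rpow_nonneg (hypos η j).le _)]
      exact Real.rpow_le_one (hypos η j).le (hymem η j).2 ha.le)
    (ℓ := fun η => a / δ η) (continuous_const.div hδc fun η => (hδ0 η).ne')
    (fun η => (div_pos ha (hδ0 η)).le)
    (fun η i j => by
      refine (abs_rpow_sub_rpow_le ha (hδ0 η) (hymem η i) (hymem η j)).trans ?_
      rw [mul_comm (max η 0), mul_assoc]
      refine mul_le_mul_of_nonneg_left ?_ (div_pos ha (hδ0 η)).le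
      refine (abs_max_sub_max_le_abs _ _ _).trans ?_
      have h1 : 1 - max η 0 * k i ^ 2 - (1 - max η 0 * k j ^ 2)
          = -(max η 0 * ((k i - k j) * (k i + k j))) := by ring
      rw [h1, abs_neg, abs_mul, abs_of_nonneg (le_max_right η 0), abs_mul]
      refine mul_le_mul_of_nonneg_left ?_ (le_max_right _ _)
      have h2 : |k i + k j| ≤ 1 := by
        rw [abs_of_nonneg (add_nonneg (hk0 i) (hk0 j))]
        linarith [hk1 i, hk1 j]
      calc _ ≤ |k i - k j| * 1 := mul_le_mul_of_nonneg_left h2 (abs_nonneg _)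
        _ ≤ _ := by rw [mul_one]; exact hklip i j)
  have hΦc : Continuous fun η => y η (κ η) ^ a := hHc.comp (continuous_id.prodMk hκc)
  have hint : ∀ ρ : ℝ, IntervalIntegrable (fun t => y (ρ * t) (κ (ρ * t)) ^ a)
      MeasureTheory.volume 0 1 := fun ρ =>
    (hΦc.comp (continuous_const.mul continuous_id)).intervalIntegrable _ _
  have hκpos : ∀ ρ, 0 < κ ρ := fun ρ => by
    rw [hκ ρ]
    refine half_pos (intervalIntegral.intervalIntegral_pos_of_pos (hint ρ) (fun t => ?_) one_pos)
    exact Real.rpow_pos_of_pos (hypos _ _) _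
  have hκle : ∀ ρ, κ ρ ≤ 1 / 2 := fun ρ => by
    have : ∫ t in (0 : ℝ)..1, y (ρ * t) (κ (ρ * t)) ^ a ≤ ∫ t in (0 : ℝ)..1, (1 : ℝ) :=
      intervalIntegral.integral_mono_on zero_le_one (hint ρ) intervalIntegrable_const fun t _ =>
        Real.rpow_le_one (hypos _ _).le (hymem _ _).2 ha.le
    simp only [intervalIntegral.integral_const, sub_zero, smul_eq_mul, mul_one] at this
    rw [hκ ρ]
    linarith
  refine ⟨κ, fun η => y η (κ η) ^ a, hκc, hΦc, hκpos, fun ρ => ?_, hκ⟩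
  have : k (κ ρ) = κ ρ := by
    simp only [hk]
    rw [min_eq_left (hκle ρ), max_eq_left (hκpos ρ).le]
  simp only [hy, this]

lemma hasDerivAt_mul_zero {g : ℝ → ℝ} (hg : ContinuousAt g 0) :
    HasDerivAt (fun r => r * g r) (g 0) 0 := by
  rw [hasDerivAt_iff_tendsto_slope]
  refine (hg.tendsto.mono_left nhdsWithin_le_nhds).congr' ?_
  filter_upwards [self_mem_nhdsWithin] with r hr
  have : r ≠ 0 := hr
  simp [slope_def_field, this]

/-- A function with positive value at `0` and positive derivative at each of its positive zeros has
no such zero. -/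
lemma pos_of_deriv_pos_of_eq_zero {D D' : ℝ → ℝ} (hD : Continuous D) (h0 : 0 < D 0)
    (hd : ∀ r, 0 < r → HasDerivAt D (D' r) r) (hpos : ∀ r, 0 < r → D r = 0 → 0 < D' r) {r : ℝ}
    (hr : 0 ≤ r) : 0 < D r := by
  by_contra! hneg
  have hS : IsCompact (Icc 0 r ∩ D ⁻¹' Iic 0) :=
    isCompact_Icc.inter_right (isClosed_Iic.preimage hD)
  obtain ⟨s, ⟨⟨hs0, hsr⟩, hsD⟩, hmin⟩ := hS.exists_isLeast ⟨r, ⟨hr, le_rfl⟩, hneg⟩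
  have hs : 0 < s := lt_of_le_of_ne hs0 fun h => by
    subst h
    exact absurd h0 (not_lt.2 hsD)
  have hbefore : ∀ t ∈ Ico 0 s, 0 < D t := fun t ht => by
    by_contra! h
    exact absurd (hmin ⟨⟨ht.1, ht.2.le.trans hsr⟩, h⟩) (not_le.2 ht.2)
  have hev : ∀ᶠ t in 𝓝[<] s, t ∈ Ioo 0 s := Ioo_mem_nhdsLT hs
  have hDs : D s = 0 := by
    have hlim : Tendsto D (𝓝[<] s) (𝓝 (D s)) :=
      hD.continuousAt.tendsto.mono_left nhdsWithin_le_nhds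
    refine le_antisymm hsD (ge_of_tendsto hlim ?_)
    filter_upwards [hev] with t ht using (hbefore t ⟨ht.1.le, ht.2⟩).le
  have hsign := eventually_nhdsWithin_sign_eq_of_deriv_pos
    (by rw [(hd s hs).deriv]; exact hpos s hs hDs) hDs
  obtain ⟨t, ht, hst⟩ := (hev.and (hsign.filter_mono nhdsWithin_le_nhds)).exists
  rw [sign_pos (hbefore t ⟨ht.1.le, ht.2⟩), sign_neg (sub_neg.2 ht.2)] at hst
  simp at hst

/-- The profile of the bowl soliton. With `ρ = r²` and `v` the radial derivative of the soliton,
`κ(ρ) = v / (r √(1 + v²))`; the equation becomes `2 (ρ κ)' = (1 - ρ κ²) ^ (α / 2)`, and the last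
inequality states that `ρ κ²`, the square of the sine of the slope angle, increases. -/
theorem exists_bowl_profile {α : ℝ} (hα : 0 < α) : ∃ κ κ' : ℝ → ℝ,
    (∀ ρ, HasDerivAt κ (κ' ρ) ρ) ∧ Continuous κ' ∧ (∀ ρ, ρ * κ ρ ^ 2 < 1) ∧
    (∀ ρ, 0 ≤ ρ → 0 < κ ρ) ∧
    (∀ ρ, 0 ≤ ρ → 2 * κ ρ + 2 * ρ * κ' ρ = (1 - ρ * κ ρ ^ 2) ^ (α / 2)) ∧
    ∀ ρ, 0 ≤ ρ → κ ρ < (1 - ρ * κ ρ ^ 2) ^ (α / 2) := by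
  have ha : 0 < α / 2 := half_pos hα
  obtain ⟨δ, hδc, hδanti, hδ0, hδ1, hδ⟩ := exists_barrier hα
  obtain ⟨κ, Φ, hκc, hΦc, hκ0, hΦ, hκ⟩ := exists_truncated_profile ha hδc hδ0 hδ1
  have hprim : ∀ ρ, ρ * κ ρ = (∫ t in (0 : ℝ)..ρ, Φ t) / 2 := fun ρ => by
    rw [hκ ρ, mul_div_assoc', intervalIntegral.mul_integral_comp_mul_left, mul_zero, mul_one]
  have hm : ∀ ρ, HasDerivAt (fun r => r * κ r) (Φ ρ / 2) ρ := fun ρ => by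
    have : (fun r => r * κ r) = fun r => (∫ t in (0 : ℝ)..r, Φ t) / 2 := funext hprim
    rw [this]
    exact (hΦc.integral_hasStrictDerivAt 0 ρ).hasDerivAt.div_const 2
  have hκd : ∀ ρ, 0 < ρ → HasDerivAt κ ((Φ ρ / 2 - κ ρ) / ρ) ρ := fun ρ hρ => by
    have h := (hm ρ).div (hasDerivAt_id ρ) hρ.ne'
    refine (h.congr_of_eventuallyEq ?_).congr_deriv ?_
    · filter_upwards [lt_mem_nhds hρ] with r hr
      simp only [Pi.div_apply, id]
      field_simp
    · simp only [id]
      field_simp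
  have hκzero : κ 0 = Φ 0 / 2 := by simpa using hκ 0
  have hx : ∀ ρ, 0 ≤ ρ → HasDerivAt (fun r => r * κ r ^ 2) (κ ρ * (Φ ρ - κ ρ)) ρ := by
    intro ρ hρ
    rcases hρ.eq_or_lt with rfl | hρ
    · refine (hasDerivAt_mul_zero (g := fun r => κ r ^ 2) (by fun_prop)).congr_deriv ?_
      rw [show Φ 0 = 2 * κ 0 by linarith]
      ring
    · have h := (hm ρ).mul (hκd ρ hρ)
      refine (h.congr_of_eventuallyEq (Eventually.of_forall fun r => ?_)).congr_deriv ?_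
      · simp only [Pi.mul_apply]; ring
      · field_simp
        ring
  -- the barrier shows that the truncation is never active
  have hbar : ∀ ρ, 0 ≤ ρ → ρ * κ ρ ^ 2 ≤ 1 - δ ρ := by
    intro ρ hρ
    refine image_le_of_deriv_right_lt_deriv_boundary (f := fun r => r * κ r ^ 2)
      (f' := fun r => κ r * (Φ r - κ r)) (B := fun _ => 1 - δ ρ) (B' := fun _ => 0)
      (by fun_prop) (fun r hr => (hx r hr.1).hasDerivWithinAt) ?_
      (fun _ => hasDerivAt_const _ _) (fun r hr heq => ?_) (right_mem_Icc.2 hρ)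
    · linarith [hδ1 ρ]
    · have hr0 : 0 ≤ r := hr.1
      have hδr : δ ρ ≤ δ r := hδanti hr.2.le
      have hΦr : Φ r = δ r ^ (α / 2) := by
        rw [hΦ, max_eq_left hr0, max_eq_right]
        rw [heq]; linarith
      have hlt : Φ r < κ r := by
        by_contra! hle
        have h1 : κ r ^ 2 ≤ δ r ^ α := by
          have h2 : κ r ^ 2 ≤ (δ r ^ (α / 2)) ^ 2 := by
            rw [← hΦr]; exact pow_le_pow_left₀ (hκ0 r).le hle 2
          rwa [← Real.rpow_mul_natCast (hδ0 r).le, Nat.cast_ofNat, div_mul_cancel₀ _ two_ne_zero]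
            at h2
        have h3 := mul_le_mul_of_nonneg_left h1 hr0
        have h4 := hδ r hr0
        rw [heq] at h3
        linarith
      exact mul_neg_of_pos_of_neg (hκ0 r) (sub_neg.2 hlt)
  have hx1 : ∀ ρ, ρ * κ ρ ^ 2 < 1 := by
    intro ρ
    rcases le_or_gt 0 ρ with hρ | hρ
    · linarith [hbar ρ hρ, hδ0 ρ]
    · linarith [mul_nonpos_of_nonpos_of_nonneg hρ.le (sq_nonneg (κ ρ))]
  have hΦeq : ∀ ρ, 0 ≤ ρ → Φ ρ = (1 - ρ * κ ρ ^ 2) ^ (α / 2) := fun ρ hρ => by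
    rw [hΦ, max_eq_left hρ, max_eq_left]
    linarith [hbar ρ hρ]
  have hΦd : ∀ ρ, 0 ≤ ρ → HasDerivAt (fun r => (1 - r * κ r ^ 2) ^ (α / 2))
      (-(κ ρ * (Φ ρ - κ ρ)) * (α / 2) * (1 - ρ * κ ρ ^ 2) ^ (α / 2 - 1)) ρ := fun ρ hρ => by
    simpa using ((hx ρ hρ).const_sub 1).rpow_const (p := α / 2) (Or.inl (sub_pos.2 (hx1 ρ)).ne')
  have hD : ∀ ρ, 0 ≤ ρ → 0 < Φ ρ - κ ρ := by
    intro ρ hρ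
    refine pos_of_deriv_pos_of_eq_zero (D := fun r => Φ r - κ r) (D' := fun r =>
      -(κ r * (Φ r - κ r)) * (α / 2) * (1 - r * κ r ^ 2) ^ (α / 2 - 1) - (Φ r / 2 - κ r) / r)
      (hΦc.sub hκc) ?_ (fun r hr => ?_) (fun r hr hz => ?_) hρ
    · linarith [hκ0 0]
    · refine HasDerivAt.sub ((hΦd r hr.le).congr_of_eventuallyEq ?_) (hκd r hr)
      filter_upwards [lt_mem_nhds hr] with s hs using hΦeq s hs.le
    · have hΦκ : Φ r = κ r := sub_eq_zero.1 hz
      have h1 : 0 < κ r / 2 / r := by have := hκ0 r; positivity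
      rw [hz, hΦκ, show κ r / 2 - κ r = -(κ r / 2) by ring, neg_div]
      simpa using h1
  -- extending `Φ` from `[0, ∞)` to a `C¹` function on the line makes its averages `C¹`
  set Ψ : ℝ → ℝ := fun r => -(κ r * (Φ r - κ r)) * (α / 2) * (1 - r * κ r ^ 2) ^ (α / 2 - 1) with hΨ
  have hΨc : Continuous Ψ := by
    refine Continuous.mul (by fun_prop) (Continuous.rpow_const (by fun_prop) fun r => Or.inl ?_)
    exact (sub_pos.2 (hx1 r)).ne'
  set F : ℝ → ℝ := fun r => Φ 0 + ∫ t in (0 : ℝ)..r, Ψ t with hF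
  have hFd : ∀ r, HasDerivAt F (Ψ r) r := fun r =>
    (hΨc.integral_hasStrictDerivAt 0 r).hasDerivAt.const_add _
  have hFΦ : ∀ r, 0 ≤ r → F r = Φ r := by
    intro r hr
    have := intervalIntegral.integral_eq_sub_of_hasDerivAt (a := 0) (b := r)
      (fun t ht => hΦd t (by rw [uIcc_of_le hr] at ht; exact ht.1)) (hΨc.intervalIntegrable _ _)
    rw [← hΦeq r hr, ← hΦeq 0 le_rfl] at this
    simp only [hF, hΨ, this]
    ring
  set κ₁ : ℝ → ℝ := fun ρ => (∫ t in (0 : ℝ)..1, F (ρ * t)) / 2 with hκ₁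
  have hκκ : ∀ ρ, 0 ≤ ρ → κ₁ ρ = κ ρ := by
    intro ρ hρ
    rw [hκ ρ]
    simp only [hκ₁]
    congr 1
    refine intervalIntegral.integral_congr fun t ht => hFΦ _ ?_
    rw [uIcc_of_le zero_le_one] at ht
    exact mul_nonneg hρ ht.1
  have hκ₁d : ∀ ρ, HasDerivAt κ₁ ((∫ t in (0 : ℝ)..1, t * Ψ (ρ * t)) / 2) ρ := fun ρ =>
    (hasDerivAt_average hFd hΨc ρ).div_const 2
  refine ⟨κ₁, _, hκ₁d, ?_, fun ρ => ?_, fun ρ hρ => ?_, fun ρ hρ => ?_, fun ρ hρ => ?_⟩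
  · refine Continuous.div_const ?_ 2
    exact intervalIntegral.continuous_parametric_intervalIntegral_of_continuous'
      (f := fun ρ t => t * Ψ (ρ * t)) (by fun_prop) 0 1
  · rcases le_or_gt 0 ρ with hρ | hρ
    · rw [hκκ ρ hρ]; exact hx1 ρ
    · linarith [mul_nonpos_of_nonpos_of_nonneg hρ.le (sq_nonneg (κ₁ ρ))]
  · rw [hκκ ρ hρ]; exact hκ0 ρ
  · rw [hκκ ρ hρ, ← hΦeq ρ hρ]
    rcases hρ.eq_or_lt with rfl | hρ'
    · linarith
    · have h := (hκ₁d ρ).unique ((hκd ρ hρ').congr_of_eventuallyEq (by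
        filter_upwards [lt_mem_nhds hρ'] with r hr using hκκ r hr.le))
      rw [h]
      field_simp
      ring
  · rw [hκκ ρ hρ, ← hΦeq ρ hρ]
    linarith [hD ρ hρ]

/-! ### The bowl soliton -/

lemma StrictConvexOn.comp_norm_of_strictMonoOn {V : Type*} [NormedAddCommGroup V] [NormedSpace ℝ V]
    [StrictConvexSpace ℝ V] {f : ℝ → ℝ} (hf : StrictConvexOn ℝ (Ici 0) f)
    (hmono : StrictMonoOn f (Ici 0)) : StrictConvexOn ℝ univ fun x : V => f ‖x‖ := by
  refine ⟨convex_univ, fun x _ y _ hxy a b ha hb hab => ?_⟩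
  rcases eq_or_ne ‖x‖ ‖y‖ with h | h
  · have hlt := norm_combo_lt_of_ne (le_refl ‖x‖) h.ge hxy ha hb hab
    calc f ‖a • x + b • y‖ < f ‖x‖ := hmono (norm_nonneg _) (norm_nonneg _) hlt
      _ = a • f ‖x‖ + b • f ‖y‖ := by rw [← h, ← add_smul, hab, one_smul]
  · have hle : ‖a • x + b • y‖ ≤ a • ‖x‖ + b • ‖y‖ := by
      refine (norm_add_le _ _).trans_eq ?_
      rw [norm_smul, norm_smul, Real.norm_of_nonneg ha.le, Real.norm_of_nonneg hb.le]
      rfl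
    exact (hmono.monotoneOn (norm_nonneg _) ((norm_nonneg _).trans hle) hle).trans_lt
      (hf.2 (norm_nonneg _) (norm_nonneg _) h ha hb hab)

/-- The divergence of a radial field, including the centre. -/
lemma planeDiv_radial {κ : ℝ → ℝ} {k' : ℝ} {x : Plane} (h : HasDerivAt κ k' (‖x‖ ^ 2)) :
    planeDiv (fun y => κ (‖y‖ ^ 2) • y) x = 2 * κ (‖x‖ ^ 2) + 2 * ‖x‖ ^ 2 * k' := by
  have h1 : HasFDerivAt (fun y : Plane => κ (‖y‖ ^ 2)) (k' • (2 • innerSL ℝ x)) x :=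
    h.comp_hasFDerivAt x (hasStrictFDerivAt_norm_sq x).hasFDerivAt
  have key : ∀ i : Fin 2, fderiv ℝ (fun y : Plane => (κ (‖y‖ ^ 2) • y) i) x
      (EuclideanSpace.single i 1) = κ (‖x‖ ^ 2) + 2 * k' * x i ^ 2 := by
    intro i
    have h2 := h1.mul (EuclideanSpace.proj (𝕜 := ℝ) i).hasFDerivAt
    have h3 : (fun y : Plane => (κ (‖y‖ ^ 2) • y) i) = fun y => κ (‖y‖ ^ 2) * y i := by
      ext y; simp
    rw [h3]
    erw [h2.fderiv]
    simp [EuclideanSpace.inner_single_right]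
    ring
  simp only [planeDiv, Fin.sum_univ_two, key]
  rw [EuclideanSpace.norm_sq_eq]
  simp [Fin.sum_univ_two]
  ring

theorem exists_isBowlSoliton {α : ℝ} (hα : 0 < α) (R : ℝ) :
    ∃ b : Plane → ℝ, IsBowlSoliton α b ∧ ∀ y, ‖y‖ = R → b y = 0 := by
  obtain ⟨κ, κ', hκd, hκ'c, hlt, hpos, heq, hmono⟩ := exists_bowl_profile hα
  have hκC : ContDiff ℝ 1 κ := by
    rw [contDiff_one_iff_deriv]
    exact ⟨fun ρ => (hκd ρ).differentiableAt, by rwa [funext fun ρ => (hκd ρ).deriv]⟩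
  have hq : ∀ ρ, 0 < 1 - ρ * κ ρ ^ 2 := fun ρ => sub_pos.2 (hlt ρ)
  have hsq : ∀ ρ, 0 < √(1 - ρ * κ ρ ^ 2) := fun ρ => Real.sqrt_pos.2 (hq ρ)
  set ψ : ℝ → ℝ := fun ρ => κ ρ / √(1 - ρ * κ ρ ^ 2) with hψ
  have hψC : ContDiff ℝ 1 ψ :=
    hκC.div ((contDiff_const.sub (contDiff_id.mul (hκC.pow 2))).sqrt fun ρ => (hq ρ).ne')
      fun ρ => (hsq ρ).ne'
  have hψpos : ∀ ρ, 0 ≤ ρ → 0 < ψ ρ := fun ρ hρ => div_pos (hpos ρ hρ) (hsq ρ)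
  have hψsq : ∀ ρ, 1 + ρ * ψ ρ ^ 2 = (1 - ρ * κ ρ ^ 2)⁻¹ := fun ρ => by
    have := hq ρ
    simp only [hψ, div_pow, Real.sq_sqrt this.le]
    field_simp
    ring
  set B : ℝ → ℝ := fun ρ => (∫ t in (R ^ 2)..ρ, ψ t) / 2 with hB
  have hBd : ∀ ρ, HasDerivAt B (ψ ρ / 2) ρ := fun ρ =>
    (hψC.continuous.integral_hasStrictDerivAt _ ρ).hasDerivAt.div_const 2
  have hBC : ContDiff ℝ 2 B := by
    rw [show (2 : WithTop ℕ∞) = 1 + 1 by norm_num, contDiff_succ_iff_deriv]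
    refine ⟨fun ρ => (hBd ρ).differentiableAt, by simp, ?_⟩
    rw [funext fun ρ => (hBd ρ).deriv]
    exact hψC.div_const 2
  -- the profile curve and its slope
  have hfd : ∀ r, HasDerivAt (fun r => B (r ^ 2)) (r * ψ (r ^ 2)) r := fun r => by
    refine ((hBd (r ^ 2)).comp r (hasDerivAt_pow 2 r)).congr_deriv ?_
    simp
    ring
  have hfc : Continuous fun r => B (r ^ 2) := hBC.continuous.comp (continuous_pow 2)
  have hfmono : StrictMonoOn (fun r => B (r ^ 2)) (Ici 0) := by
    refine strictMonoOn_of_deriv_pos (convex_Ici 0) hfc.continuousOn fun r hr => ?_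
    rw [interior_Ici] at hr
    rw [(hfd r).deriv]
    exact mul_pos hr (hψpos _ (sq_nonneg r))
  have hxmono : StrictMonoOn (fun ρ => ρ * κ ρ ^ 2) (Ici 0) := by
    refine strictMonoOn_of_deriv_pos (convex_Ici 0)
      (continuous_id.mul (hκC.continuous.pow 2)).continuousOn fun ρ hρ => ?_
    rw [interior_Ici] at hρ
    have hρ' : 0 ≤ ρ := le_of_lt hρ
    have hd : HasDerivAt (fun ρ => ρ * κ ρ ^ 2)
        (κ ρ * ((2 * κ ρ + 2 * ρ * κ' ρ) - κ ρ)) ρ := by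
      refine ((hasDerivAt_id ρ).mul ((hκd ρ).pow 2)).congr_deriv ?_
      simp
      ring
    rw [hd.deriv, heq ρ hρ']
    exact mul_pos (hpos ρ hρ') (sub_pos.2 (hmono ρ hρ'))
  have hvmono : StrictMonoOn (fun r => r * ψ (r ^ 2)) (Ici 0) := by
    intro r hr s hs hrs
    have hr0 : 0 ≤ r := hr
    have hs0 : 0 ≤ s := hs
    refine lt_of_pow_lt_pow_left₀ 2 (mul_nonneg hs0 (hψpos _ (sq_nonneg s)).le) ?_
    have h1 := hxmono (mem_Ici.2 (sq_nonneg r)) (mem_Ici.2 (sq_nonneg s))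
      (pow_lt_pow_left₀ hrs hr0 two_ne_zero)
    have h2 : (1 - r ^ 2 * κ (r ^ 2) ^ 2)⁻¹ < (1 - s ^ 2 * κ (s ^ 2) ^ 2)⁻¹ :=
      inv_strictAnti₀ (hq _) (sub_lt_sub_left h1 1)
    rw [← hψsq, ← hψsq] at h2
    simp only [mul_pow]
    linarith
  have hfconv : StrictConvexOn ℝ (Ici 0) fun r => B (r ^ 2) := by
    refine StrictMonoOn.strictConvexOn_of_deriv (convex_Ici 0) hfc.continuousOn ?_
    rw [funext fun r => (hfd r).deriv]
    exact hvmono.mono interior_subset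
  have hgrad : gradient (fun x : Plane => B (‖x‖ ^ 2)) = fun x => ψ (‖x‖ ^ 2) • x := by
    refine gradient_eq fun x => ?_
    rw [hasGradientAt_iff_hasFDerivAt]
    refine ((hBd (‖x‖ ^ 2)).comp_hasFDerivAt x
      (hasStrictFDerivAt_norm_sq x).hasFDerivAt).congr_fderiv ?_
    ext y
    simp
    ring
  have hW : ∀ x : Plane, 1 / √(1 + ‖ψ (‖x‖ ^ 2) • x‖ ^ 2) = √(1 - ‖x‖ ^ 2 * κ (‖x‖ ^ 2) ^ 2) := by
    intro x
    rw [norm_smul, mul_pow, Real.norm_eq_abs, sq_abs, mul_comm (ψ _ ^ 2), hψsq, Real.sqrt_inv,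
      one_div, inv_inv]
  refine ⟨fun x => B (‖x‖ ^ 2), ⟨hBC.comp (contDiff_norm_sq ℝ), fun x => ?_,
    fun x y hxy => by simp only [hxy], hfconv.comp_norm_of_strictMonoOn hfmono, fun x => ?_⟩,
    fun y hy => by simp [hB, hy]⟩
  · rw [SolitonEqAt, hgrad]
    have hfield : (fun y : Plane => (1 / √(1 + ‖ψ (‖y‖ ^ 2) • y‖ ^ 2)) • ψ (‖y‖ ^ 2) • y)
        = fun y => κ (‖y‖ ^ 2) • y := by
      ext1 y
      rw [hW, smul_smul]
      congr 1
      exact mul_div_cancel₀ _ (hsq _).ne'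
    rw [hfield, planeDiv_radial (hκd _), heq _ (sq_nonneg _), hW, Real.sqrt_eq_rpow,
      ← Real.rpow_mul (hq _).le]
    congr 1
    ring
  · have := hfmono.monotoneOn (mem_Ici.2 le_rfl) (mem_Ici.2 (norm_nonneg x)) (norm_nonneg x)
    simpa using this

/-! ### The Dirichlet problem -/

theorem mainTheorem3 (α : ℝ) (hα : 0 < α)
    (Ω : Set Plane) (hΩ_open : IsOpen Ω) (hΩ_conn : IsConnected Ω)
    (hΩ_bdd : Bornology.IsBounded Ω)
    (φ : Plane → ℝ) (hφ : ContinuousOn φ (frontier Ω)) :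
    -- uniqueness
    (∀ u v : Plane → ℝ, IsDirichletSolution α Ω φ u → IsDirichletSolution α Ω φ v →
      EqOn u v (closure Ω)) ∧
    -- the two bounds; `m` and `M` are the minimum and the maximum of `φ` on the boundary
    (∃ m M : ℝ, IsLeast (φ '' frontier Ω) m ∧ IsGreatest (φ '' frontier Ω) M ∧
      (∃ C : ℝ, ∀ u : Plane → ℝ, IsDirichletSolution α Ω φ u → ∀ x ∈ Ω, C ≤ u x ∧ u x ≤ M) ∧
      -- the lower bound given by the bowl soliton that vanishes on a circle around `Ω`
      (∀ (p : Plane) (R : ℝ), closure Ω ⊆ ball p R →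
        (∃ b : Plane → ℝ, IsBowlSoliton α b ∧ ∀ y, ‖y‖ = R → b y = 0) ∧
        ∀ b : Plane → ℝ, IsBowlSoliton α b → (∀ y, ‖y‖ = R → b y = 0) →
          ∀ u : Plane → ℝ, IsDirichletSolution α Ω φ u → ∀ x ∈ Ω, b 0 + m ≤ u x)) ∧
    -- the maximum of `|Du|` over the closure is its maximum over the boundary
    (∀ u : Plane → ℝ, IsDirichletSolution α Ω φ u →
      ∃ K : ℝ, IsGreatest ((fun x => ‖closureGradient Ω u x‖) '' closure Ω) K ∧
        IsGreatest ((fun x => ‖closureGradient Ω u x‖) '' frontier Ω) K) := by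
  have hcpt : IsCompact (closure Ω) := hΩ_bdd.isCompact_closure
  have hfcpt : IsCompact (frontier Ω) :=
    hcpt.of_isClosed_subset isClosed_frontier frontier_subset_closure
  have hfne := frontier_nonempty_of_isBounded hΩ_conn.nonempty hΩ_bdd
  refine ⟨fun u v hu hv => hu.eqOn hΩ_open hΩ_bdd hv, ?_, fun u hu => ?_⟩
  · obtain ⟨m, hm⟩ := (hfcpt.image_of_continuousOn hφ).exists_isLeast (hfne.image φ)
    obtain ⟨M, hM⟩ := (hfcpt.image_of_continuousOn hφ).exists_isGreatest (hfne.image φ)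
    have hm' : ∀ x ∈ frontier Ω, m ≤ φ x := fun x hx => hm.2 (mem_image_of_mem φ hx)
    have hM' : ∀ x ∈ frontier Ω, φ x ≤ M := fun x hx => hM.2 (mem_image_of_mem φ hx)
    have hRpos : ∀ (p : Plane) (R : ℝ), closure Ω ⊆ ball p R → 0 < R := fun p R h => by
      obtain ⟨x, hx⟩ := hΩ_conn.nonempty
      exact nonempty_ball.1 ⟨x, h (subset_closure hx)⟩
    refine ⟨m, M, hm, hM, ?_, fun p R hpR => ⟨exists_isBowlSoliton hα R, ?_⟩⟩
    · obtain ⟨R, hR⟩ := hcpt.isBounded.subset_ball (0 : Plane)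
      obtain ⟨b, hb, hb0⟩ := exists_isBowlSoliton hα R
      exact ⟨b 0 + m, fun u hu x hx =>
        ⟨hu.bowl_le hΩ_open hΩ_bdd (hRpos 0 R hR) hR hm' hb hb0 x (subset_closure hx),
          hu.le_of_frontier hΩ_open hΩ_bdd hM' x (subset_closure hx)⟩⟩
    · exact fun b hb hb0 u hu x hx =>
        hu.bowl_le hΩ_open hΩ_bdd (hRpos p R hpR) hpR hm' hb hb0 x (subset_closure hx)
  · have hcont := (continuousOn_closureGradient_and_eqOn hu.regular).1.norm
    obtain ⟨y, hy, hymax⟩ := hfcpt.exists_isMaxOn hfne (hcont.mono frontier_subset_closure)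
    exact ⟨‖closureGradient Ω u y‖,
      ⟨mem_image_of_mem _ (frontier_subset_closure hy), by
        rintro _ ⟨x, hx, rfl⟩
        exact hu.norm_closureGradient_le hΩ_open hΩ_bdd (fun z hz => hymax hz) hx⟩,
      ⟨mem_image_of_mem _ hy, by
        rintro _ ⟨x, hx, rfl⟩
        exact hymax hx⟩⟩
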